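/- For $\alpha=(\alpha_1,\dots,\alpha_d)\in(0,\infty)^d$, the max-stable Dirichlet distribution $\mathrm{MaxDir}(\alpha)=\mathrm{MaxDir}(\alpha_1,\dots,\alpha_d)$ is the probability distribution on $\mathbb{R}^d$ whose distribution function satisfies \[ G(x)=\exp\Big(-\mathbb{E}\max_{i=1,\dots,d}\frac{Z_i}{x_i}\Big),\qquad x\in(0,\infty)^d, \] where $Z=(\Gamma_1/\alpha_1,\dots,\Gamma_d/\alpha_d)$ and $\Gamma_1,\dots,\Gamma_d$ are independent Gamma random variables, $\Gamma_i$ having the density $x^{\alpha_i-1}e^{-x}/\Gamma(\alpha_i)$ on $(0,\infty)$ (so that $Z_i\ge 0$ and $\mathbb{E}Z_i=1$). For distributions $\mu,\nu$ on $\mathbb{R}^d$ write $\mu\le_{\mathrm{PQD}}\nu$ if, for all $a\in\mathbb{R}^d$, \[ \mu(\{x: x_i>a_i \text{ for all } i\})\le\nu(\{x: x_i>a_i \text{ for all } i\}) \quad\text{and}\quad \mu(\{x: x_i\le a_i \text{ for all } i\})\le\nu(\{x: x_i\le a_i \text{ for all } i\}). \] Theorem. Let $\alpha,\beta\in(0,\infty)^d$.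 If $\alpha_i\le\beta_i$ for all $i=1,\dots,d$, then \[ \mathrm{MaxDir}(\alpha_1,\dots,\alpha_d)\le_{\mathrm{PQD}}\mathrm{MaxDir}(\beta_1,\dots,\beta_d). \] -/

import Mathlib

open MeasureTheory ProbabilityTheory

/-- The upper orthant `{x ∈ ℝᵈ : x₁ > a₁, …, x_d > a_d}`. -/
def upperOrthant {d : ℕ} (a : Fin d → ℝ) : Set (Fin d → ℝ) :=
  {x | ∀ i, a i < x i}

/-- The lower orthant `{x ∈ ℝᵈ : x₁ ≤ a₁, …, x_d ≤ a_d}`. -/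
def lowerOrthant {d : ℕ} (a : Fin d → ℝ) : Set (Fin d → ℝ) :=
  {x | ∀ i, x i ≤ a i}

/-- Upper orthant order `μ ≤_uo ν` between distributions on `ℝᵈ`: the distribution `μ` gives every
upper orthant at most the mass that `ν` gives it. -/
def LeUO {d : ℕ} (μ ν : Measure (Fin d → ℝ)) : Prop :=
  ∀ a : Fin d → ℝ, μ (upperOrthant a) ≤ ν (upperOrthant a)

/-- Lower orthant order `μ ≤_lo ν` between distributions on `ℝᵈ`: the distribution `μ` gives every
lower orthant at least the mass that `ν` gives it. -/
def LeLO {d : ℕ} (μ ν : Measure (Fin d → ℝ)) : Prop :=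
  ∀ a : Fin d → ℝ, ν (lowerOrthant a) ≤ μ (lowerOrthant a)

/-- Positive quadrant dependence (concordance) order `μ ≤_PQD ν` between distributions on `ℝᵈ`:
`μ ≤_uo ν` and `μ ≥_lo ν`. -/
def LePQD {d : ℕ} (μ ν : Measure (Fin d → ℝ)) : Prop :=
  LeUO μ ν ∧ LeLO ν μ

/-- `ρ` is the law of a generator `Z` of the simple max-stable distribution `μ` on `ℝᵈ`:
`Z` is a random vector with values in `[0, ∞)ᵈ` and `E Zᵢ = 1` for all `i`, and the distribution
function of `μ` is `G(x) = exp (-V x)` for `x ∈ (0, ∞)ᵈ`, where `V x = E (maxᵢ Zᵢ / xᵢ)`. -/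
structure IsGenerator {d : ℕ} (ρ μ : Measure (Fin d → ℝ)) : Prop where
  isProbabilityMeasure_generator : IsProbabilityMeasure ρ
  isProbabilityMeasure : IsProbabilityMeasure μ
  nonneg : ∀ᵐ z ∂ρ, ∀ i, 0 ≤ z i
  integrable : ∀ i, Integrable (fun z => z i) ρ
  mean_one : ∀ i, ∫ z, z i ∂ρ = 1
  cdf_eq : ∀ x : Fin d → ℝ, (∀ i, 0 < x i) →
    μ.real (lowerOrthant x) = Real.exp (-∫ z, (⨆ i, z i / x i) ∂ρ)

/-- The law of the Gamma generator `(Γ₁ / α₁, …, Γ_d / α_d)`, where `Γ₁, …, Γ_d` are independent and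
`Γᵢ` has the Gamma distribution with shape `αᵢ` and rate `1`. -/
noncomputable def gammaGeneratorLaw {d : ℕ} (α : Fin d → ℝ) : Measure (Fin d → ℝ) :=
  (Measure.pi fun i => gammaMeasure (α i) 1).map fun g i => g i / α i

/-- `μ` is the max-stable Dirichlet distribution `MaxDir(α₁, …, α_d)`, where `α ∈ (0, ∞)ᵈ`: the
simple max-stable distribution that has the Gamma generator with parameter `α`. -/
def IsMaxDir {d : ℕ} (α : Fin d → ℝ) (μ : Measure (Fin d → ℝ)) : Prop :=
  (∀ i, 0 < α i) ∧ IsGenerator (gammaGeneratorLaw α) μ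

/-! Gamma variables scaled to mean 1 decrease in the convex order as the shape grows: two such
densities differ by a function with sign pattern +, -, + (`integral_gammaMeasure_le_of_convexOn`).
Independence lets coordinates be replaced one at a time (`integral_pi_le_of_convexOn`), so `E F(Z)`
decreases in the shapes for every convex `F` of linear growth. With `F(z) = max c_i z_i` the
exponent decreases, so the distribution function increases; this settles lower orthants. With `F(z)
= max_{i ∈ S} (-c_i z_i)` the mean minima `E min_{i ∈ S} c_i Z_i` increase. For upper orthants, take
independent `X ∼ μ`, `Y ∼ ν` and move from `X` to `Y` along `max((1-s) X, s Y)`. Its exponent at a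
set `A` of coordinates is `(1-s) V_μ(A) + s V_ν(A)`. By inclusion-exclusion, the derivative in `s`
of its survival function at `1/c` is the mean, over the random set `N` of coordinates not exceeding
`1/c_i`, of `Σ_{A ⊆ N} (-1)^|A| (V_μ(A) - V_ν(A))`. By the maximum-minimums identity this sum is the
difference of the mean minima over `N`, which is nonnegative
(`IsGenerator.measureReal_upperOrthant_inv_le`). -/

/-! ### Convex order on the line: secants and the cut criterion. -/

/-- The secant line of a convex function lies above it between the two nodes and below it
elsewhere. -/
lemma ConvexOn.le_secant_and_secant_le {s : Set ℝ} {φ : ℝ → ℝ} (hφ : ConvexOn ℝ s φ) {u v t : ℝ}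
    (hu : u ∈ s) (hv : v ∈ s) (ht : t ∈ s) (huv : u < v) :
    (t ∈ Set.Icc u v → φ t ≤ φ u + (φ v - φ u) / (v - u) * (t - u)) ∧
      (t ∉ Set.Icc u v → φ u + (φ v - φ u) / (v - u) * (t - u) ≤ φ t) := by
  have huv' : 0 < v - u := sub_pos.2 huv
  have key : φ u + (φ v - φ u) / (v - u) * (t - u) =
      ((v - t) * φ u + (t - u) * φ v) / (v - u) := by
    field_simp; ring
  rw [key]
  constructor
  · rintro ⟨h1, h2⟩
    rw [le_div_iff₀ huv']
    rcases h1.eq_or_lt with rfl | h1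
    · linarith
    rcases h2.eq_or_lt with rfl | h2
    · linarith
    linarith [hφ.secant_mono_aux1 hu hv h1 h2]
  · intro h
    rw [div_le_iff₀ huv']
    rcases lt_or_ge t u with h1 | h1
    · linarith [hφ.secant_mono_aux1 ht hv h1 huv]
    · have h2 : v < t := by
        by_contra h2
        exact h ⟨h1, not_lt.1 h2⟩
      linarith [hφ.secant_mono_aux1 hu ht huv h2]

/-- The cut criterion for the convex order: if `D` is the difference of two densities with the same
mass and the same mean, and `D` is nonpositive between two points and nonnegative elsewhere, then
`D` has a nonnegative integral against every convex function. -/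
lemma integral_mul_nonneg_of_convexOn {D φ : ℝ → ℝ} (hφ : ConvexOn ℝ Set.univ φ) {u v : ℝ}
    (huv : u < v) (hD : Integrable D) (hD1 : Integrable fun t => D t * t)
    (hDφ : Integrable fun t => D t * φ t) (h0 : ∫ t, D t = 0) (h1 : ∫ t, D t * t = 0)
    (hin : ∀ᵐ t, t ∈ Set.Icc u v → D t ≤ 0) (hout : ∀ᵐ t, t ∉ Set.Icc u v → 0 ≤ D t) :
    0 ≤ ∫ t, D t * φ t := by
  -- `D` annihilates affine functions, so the secant of `φ` through `u` and `v` can be subtracted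
  -- for free. What remains has the sign of `D` everywhere.
  set k := (φ v - φ u) / (v - u) with hk
  have hlin : ∫ t, ((φ u - k * u) * D t + k * (D t * t)) = 0 := by
    rw [integral_add (hD.const_mul _) (hD1.const_mul _), integral_const_mul, integral_const_mul,
      h0, h1]
    simp
  have hsub : ∫ t, D t * φ t =
      ∫ t, (D t * φ t - ((φ u - k * u) * D t + k * (D t * t))) := by
    have hi : Integrable fun t => (φ u - k * u) * D t + k * (D t * t) :=
      (hD.const_mul _).add (hD1.const_mul _)
    rw [integral_sub hDφ hi, hlin, sub_zero]
  rw [hsub]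
  refine integral_nonneg_of_ae ?_
  filter_upwards [hin, hout] with t ht1 ht2
  have hs := hφ.le_secant_and_secant_le (Set.mem_univ u) (Set.mem_univ v) (Set.mem_univ t) huv
  have e : D t * φ t - ((φ u - k * u) * D t + k * (D t * t)) =
      D t * (φ t - (φ u + k * (t - u))) := by ring
  simp only [Pi.zero_apply]
  rw [e]
  by_cases ht : t ∈ Set.Icc u v
  · exact mul_nonneg_of_nonpos_of_nonpos (ht1 ht) (sub_nonpos.2 (hs.1 ht))
  · exact mul_nonneg (ht2 ht) (sub_nonneg.2 (hs.2 ht))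

/-- The function `t ↦ t - 1 - log t` takes every positive value once on each side of `1`. -/
lemma exists_sub_one_sub_log_eq {L : ℝ} (hL : 0 < L) :
    ∃ u v : ℝ, 0 < u ∧ u < v ∧ u - 1 - Real.log u = L ∧ v - 1 - Real.log v = L := by
  have hcont : ContinuousOn (fun t : ℝ => t - 1 - Real.log t) (Set.Ioi 0) :=
    (continuousOn_id.sub continuousOn_const).sub
      (Real.continuousOn_log.mono fun t ht => (ne_of_gt ht : t ≠ 0))
  -- At this point `t - 1 - log t` equals `exp (-(L + 1)) + L`, which exceeds `L`.
  have hp : 0 < Real.exp (-(L + 1)) := Real.exp_pos _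
  have hle : Real.exp (-(L + 1)) ≤ 1 := Real.exp_le_one_iff.2 (by linarith)
  obtain ⟨u, hu, hu'⟩ := intermediate_value_Icc' hle
    (hcont.mono fun t ht => lt_of_lt_of_le hp ht.1)
    (show L ∈ Set.Icc _ _ by
      constructor
      · simpa using hL.le
      · simp only [Real.log_exp]; linarith)
  -- At `w ^ 2` the bound `log w ≤ w - 1` gives `w ^ 2 - 1 - 2 log w ≥ (w - 1) ^ 2 = L`.
  set w := 1 + √L with hw
  have hw1 : 1 ≤ w := by have := Real.sqrt_nonneg L; linarith
  obtain ⟨v, hv, hv'⟩ := intermediate_value_Icc (show (1 : ℝ) ≤ w ^ 2 by nlinarith)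
    (hcont.mono fun t ht => lt_of_lt_of_le one_pos ht.1)
    (show L ∈ Set.Icc _ _ by
      constructor
      · simpa using hL.le
      · simp only [Real.log_pow]
        have h1 := Real.log_le_sub_one_of_pos (show 0 < w by linarith)
        have h2 : (w - 1) ^ 2 = L := by rw [hw, add_sub_cancel_left, Real.sq_sqrt hL.le]
        push_cast
        nlinarith)
  refine ⟨u, v, hp.trans_le hu.1, lt_of_le_of_ne (hu.2.trans hv.1) ?_, hu', hv'⟩
  intro h
  have h1 : u = 1 := le_antisymm hu.2 (h ▸ hv.1)
  rw [h1] at hu'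
  simp at hu'
  exact hL.ne hu'

lemma convexOn_sub_one_sub_log : ConvexOn ℝ (Set.Ioi 0) fun t : ℝ => t - 1 - Real.log t := by
  have h := strictConcaveOn_log_Ioi.concaveOn.neg
  have h2 : ConvexOn ℝ (Set.Ioi (0 : ℝ)) fun t : ℝ => t + (-1) :=
    (convexOn_id (convex_Ioi 0)).add_const (-1)
  exact (h2.add h).congr fun t _ => by simp [sub_eq_add_neg]

/-! ### Gamma distributions with mean one. -/

/-- Dividing a Gamma variable with rate `1` by its shape makes the rate equal to the shape. -/
lemma map_div_gammaMeasure {a : ℝ} (ha : 0 < a) :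
    (gammaMeasure a 1).map (fun g => g / a) = gammaMeasure a a := by
  ext s hs
  have hm : Measurable fun g : ℝ => g / a := measurable_id.div_const a
  have hmul : Measurable fun g : ℝ => a * g := measurable_const_mul a
  have hvol : (volume : Measure ℝ) = ENNReal.ofReal a • volume.map (fun g => a * g) := by
    rw [Real.map_volume_mul_left ha.ne', smul_smul, ← ENNReal.ofReal_mul ha.le,
      abs_of_pos (inv_pos.2 ha), mul_inv_cancel₀ ha.ne']
    simp
  have hpdf : Measurable (gammaPDF a 1) := (measurable_gammaPDFReal a 1).ennreal_ofReal
  rw [Measure.map_apply hm hs, gammaMeasure, gammaMeasure, withDensity_apply _ hs,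
    withDensity_apply _ (hm hs), ← lintegral_indicator (hm hs), ← lintegral_indicator hs]
  conv_lhs => rw [hvol]
  rw [lintegral_smul_measure, lintegral_map (hpdf.indicator (hm hs)) hmul, smul_eq_mul,
    ← lintegral_const_mul]
  swap
  · exact (hpdf.indicator (hm hs)).comp hmul
  refine lintegral_congr fun t => ?_
  by_cases ht : t ∈ s
  · have ht' : a * t ∈ (fun g : ℝ => g / a) ⁻¹' s := by
      simpa [mul_div_cancel_left₀ _ ha.ne'] using ht
    rw [Set.indicator_of_mem ht', Set.indicator_of_mem ht, gammaPDF, gammaPDF,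
      ← ENNReal.ofReal_mul ha.le]
    congr 1
    unfold gammaPDFReal
    by_cases h0 : 0 ≤ t
    · rw [if_pos h0, if_pos (by positivity), Real.mul_rpow ha.le h0, Real.rpow_sub_one ha.ne']
      simp only [Real.one_rpow, one_mul]
      field_simp
    · rw [if_neg h0, if_neg (by rw [mul_nonneg_iff_of_pos_left ha]; exact h0), mul_zero]
  · have ht' : a * t ∉ (fun g : ℝ => g / a) ⁻¹' s := by
      simpa [mul_div_cancel_left₀ _ ha.ne'] using ht
    rw [Set.indicator_of_notMem ht', Set.indicator_of_notMem ht, mul_zero]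

lemma integral_gammaMeasure {a r : ℝ} (ha : 0 < a) (hr : 0 < r) (φ : ℝ → ℝ) :
    ∫ t, φ t ∂gammaMeasure a r = ∫ t, gammaPDFReal a r t * φ t := by
  rw [gammaMeasure, integral_withDensity_eq_integral_toReal_smul (f := gammaPDF a r)
    (measurable_gammaPDFReal a r).ennreal_ofReal (by simp [gammaPDF])]
  simp [gammaPDF, ENNReal.toReal_ofReal (gammaPDFReal_nonneg ha hr _)]

lemma integrable_gammaMeasure_iff {a r : ℝ} (ha : 0 < a) (hr : 0 < r) (φ : ℝ → ℝ) :
    Integrable φ (gammaMeasure a r) ↔ Integrable fun t => gammaPDFReal a r t * φ t := by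
  rw [gammaMeasure, integrable_withDensity_iff_integrable_smul' (f := gammaPDF a r)
    (measurable_gammaPDFReal a r).ennreal_ofReal (by simp [gammaPDF])]
  simp [gammaPDF, ENNReal.toReal_ofReal (gammaPDFReal_nonneg ha hr _)]

/-- Size-biasing raises the shape by one, so the first moment is read off from the total mass of
another Gamma law. -/
lemma gammaPDFReal_mul_self {a r : ℝ} (ha : 0 < a) (hr : 0 < r) (t : ℝ) (ht : t ≠ 0) :
    gammaPDFReal a r t * t = a / r * gammaPDFReal (a + 1) r t := by
  unfold gammaPDFReal
  split_ifs with h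
  · have h' : 0 < t := lt_of_le_of_ne h ht.symm
    rw [Real.Gamma_add_one ha.ne', Real.rpow_add_one hr.ne', add_sub_cancel_right,
      Real.rpow_sub_one h'.ne']
    have := (Real.Gamma_pos_of_pos ha).ne'
    field_simp
  · simp

lemma integrable_id_gammaMeasure {a r : ℝ} (ha : 0 < a) (hr : 0 < r) :
    Integrable (fun t => t) (gammaMeasure a r) := by
  have := isProbabilityMeasure_gammaMeasure (a := a + 1) (by linarith) hr
  have h := (integrable_gammaMeasure_iff (a := a + 1) (by linarith) hr _).1
    (integrable_const (1 : ℝ))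
  rw [integrable_gammaMeasure_iff ha hr]
  refine (h.const_mul (a / r)).congr ?_
  filter_upwards [Measure.ae_ne volume (0 : ℝ)] with t ht
  rw [gammaPDFReal_mul_self ha hr t ht, mul_one]

lemma integral_id_gammaMeasure {a r : ℝ} (ha : 0 < a) (hr : 0 < r) :
    ∫ t, t ∂gammaMeasure a r = a / r := by
  have := isProbabilityMeasure_gammaMeasure (a := a + 1) (by linarith) hr
  have h := integral_gammaMeasure (a := a + 1) (by linarith) hr (fun _ => 1)
  simp only [integral_const, probReal_univ, smul_eq_mul, mul_one] at h
  rw [integral_gammaMeasure ha hr,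
    integral_congr_ae (g := fun t => a / r * gammaPDFReal (a + 1) r t),
    integral_const_mul, ← h, mul_one]
  filter_upwards [Measure.ae_ne volume (0 : ℝ)] with t ht
  rw [gammaPDFReal_mul_self ha hr t ht]

lemma gammaPDFReal_eq_exp {a r t : ℝ} (ha : 0 < a) (hr : 0 < r) (ht : 0 < t) :
    gammaPDFReal a r t =
      Real.exp (Real.log (r ^ a / Real.Gamma a) + (a - 1) * Real.log t - r * t) := by
  have := Real.Gamma_pos_of_pos ha
  rw [gammaPDFReal, if_pos ht.le, sub_eq_add_neg _ (r * t), Real.exp_add, Real.exp_add,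
    Real.exp_log (by positivity), Real.rpow_def_of_pos ht, mul_comm (Real.log t)]

/-- The Gamma distributions with mean `1` decrease in the convex order as the shape grows. -/
theorem integral_gammaMeasure_le_of_convexOn {a b : ℝ} (ha : 0 < a) (hab : a ≤ b) {φ : ℝ → ℝ}
    (hφ : ConvexOn ℝ Set.univ φ) (hia : Integrable φ (gammaMeasure a a))
    (hib : Integrable φ (gammaMeasure b b)) :
    ∫ t, φ t ∂gammaMeasure b b ≤ ∫ t, φ t ∂gammaMeasure a a := by
  rcases hab.eq_or_lt with rfl | hab
  · rfl
  have hb : 0 < b := ha.trans hab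
  have := isProbabilityMeasure_gammaMeasure ha ha
  have := isProbabilityMeasure_gammaMeasure hb hb
  have i0a := (integrable_gammaMeasure_iff ha ha _).1 (integrable_const (1 : ℝ))
  have i0b := (integrable_gammaMeasure_iff hb hb _).1 (integrable_const (1 : ℝ))
  have i1a := (integrable_gammaMeasure_iff ha ha _).1 (integrable_id_gammaMeasure ha ha)
  have i1b := (integrable_gammaMeasure_iff hb hb _).1 (integrable_id_gammaMeasure hb hb)
  have iφa := (integrable_gammaMeasure_iff ha ha _).1 hia
  have iφb := (integrable_gammaMeasure_iff hb hb _).1 hib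
  have e0a := integral_gammaMeasure ha ha fun _ => 1
  have e0b := integral_gammaMeasure hb hb fun _ => 1
  have e1a := integral_gammaMeasure ha ha fun t => t
  have e1b := integral_gammaMeasure hb hb fun t => t
  simp only [integral_const, probReal_univ, smul_eq_mul, mul_one] at e0a e0b i0a i0b
  rw [integral_id_gammaMeasure ha ha, div_self ha.ne'] at e1a
  rw [integral_id_gammaMeasure hb hb, div_self hb.ne'] at e1b
  rw [integral_gammaMeasure ha ha, integral_gammaMeasure hb hb, ← sub_nonneg,
    ← integral_sub iφa iφb]
  set D : ℝ → ℝ := fun t => gammaPDFReal a a t - gammaPDFReal b b t with hD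
  have hDi : Integrable D := i0a.sub i0b
  have hDi1 : Integrable fun t => D t * t := by
    simp only [hD, sub_mul]
    exact i1a.sub i1b
  have hDiφ : Integrable fun t => D t * φ t := by
    simp only [hD, sub_mul]
    exact iφa.sub iφb
  have hD0 : ∫ t, D t = 0 := by
    simp only [hD]
    rw [integral_sub i0a i0b, ← e0a, ← e0b, sub_self]
  have hD1 : ∫ t, D t * t = 0 := by
    simp only [hD, sub_mul]
    rw [integral_sub i1a i1b, ← e1a, ← e1b, sub_self]
  simp only [← sub_mul]
  change 0 ≤ ∫ t, D t * φ t
  -- For `t > 0` the log-ratio of the density with shape `b` to that with shape `a` is `(b - a) * (K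
  -- - (t - 1 - log t))`. Hence the sign of `D` is that of `t - 1 - log t - K`.
  set K : ℝ := (Real.log (b ^ b / Real.Gamma b) - Real.log (a ^ a / Real.Gamma a)) / (b - a) - 1
    with hK
  have hba : 0 < b - a := sub_pos.2 hab
  have hKe : Real.log (b ^ b / Real.Gamma b) - Real.log (a ^ a / Real.Gamma a) =
      (b - a) * (K + 1) := by
    rw [hK]; field_simp; ring
  have hneg : ∀ t < 0, D t = 0 := fun t ht => by
    simp [hD, gammaPDFReal, not_le.2 ht]
  have hpos : ∀ t, 0 < t → K ≤ t - 1 - Real.log t → 0 ≤ D t := fun t ht h => by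
    simp only [hD, sub_nonneg]
    rw [gammaPDFReal_eq_exp ha ha ht, gammaPDFReal_eq_exp hb hb ht, Real.exp_le_exp]
    linarith [mul_le_mul_of_nonneg_left h hba.le]
  have hnonpos : ∀ t, 0 < t → t - 1 - Real.log t ≤ K → D t ≤ 0 := fun t ht h => by
    simp only [hD, sub_nonpos]
    rw [gammaPDFReal_eq_exp ha ha ht, gammaPDFReal_eq_exp hb hb ht, Real.exp_le_exp]
    linarith [mul_le_mul_of_nonneg_left h hba.le]
  -- If `K ≤ 0`, then `D` is nonnegative with zero integral, hence zero almost everywhere.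
  rcases le_or_gt K 0 with hK0 | hK0
  · have hDn : 0 ≤ᵐ[volume] D := by
      filter_upwards [Measure.ae_ne volume (0 : ℝ)] with t ht
      rcases ht.lt_or_gt with h | h
      · exact (hneg t h).ge
      · refine hpos t h ?_
        linarith [Real.log_le_sub_one_of_pos h]
    have hz := (integral_eq_zero_iff_of_nonneg_ae hDn hDi).1 hD0
    rw [integral_eq_zero_of_ae]
    filter_upwards [hz] with t ht
    simp [ht]
  · obtain ⟨u, v, hu, huv, hu', hv'⟩ := exists_sub_one_sub_log_eq hK0
    -- The secant of `t - 1 - log t` through `u` and `v` is horizontal at height `K`, so the cut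
    -- points of `D` are exactly `u` and `v`.
    have hsec := fun t (ht : 0 < t) => convexOn_sub_one_sub_log.le_secant_and_secant_le
      (Set.mem_Ioi.2 hu) (Set.mem_Ioi.2 (hu.trans huv)) (Set.mem_Ioi.2 ht) huv
    simp only [hu', hv', sub_self, zero_div, zero_mul, add_zero] at hsec
    refine integral_mul_nonneg_of_convexOn hφ huv hDi hDi1 hDiφ hD0 hD1 ?_ ?_
    · exact Filter.Eventually.of_forall fun t ht =>
        hnonpos t (hu.trans_le ht.1) ((hsec t (hu.trans_le ht.1)).1 ht)
    · filter_upwards [Measure.ae_ne volume (0 : ℝ)] with t h0 ht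
      rcases h0.lt_or_gt with h | h
      · exact (hneg t h).ge
      · exact hpos t h ((hsec t h).2 ht)

/-! ### Convex order for vectors with independent coordinates. -/

/-- Linear growth guarantees integrability under every hybrid product met while coordinates are
being replaced. -/
lemma integrable_pi_of_abs_le {ι : Type*} [Fintype ι] (γ : ι → Measure ℝ)
    [∀ i, IsProbabilityMeasure (γ i)] (hγ : ∀ i, Integrable (fun t => t) (γ i))
    {F : (ι → ℝ) → ℝ} (hF : Measurable F) {C : ι → ℝ}
    (hC : ∀ z, |F z| ≤ ∑ i, C i * |z i|) : Integrable F (Measure.pi γ) := by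
  have h : Integrable (fun z : ι → ℝ => ∑ i, C i * |z i|) (Measure.pi γ) := by
    refine integrable_finsetSum _ fun i _ => ?_
    exact (integrable_comp_eval (μ := γ) (hγ i)).abs.const_mul _
  exact h.mono' hF.aestronglyMeasurable (Filter.Eventually.of_forall hC)

/-- Replacing one coordinate of a random vector with independent coordinates by one that is smaller
in the convex order decreases the integral of every convex function of linear growth. -/
lemma integral_pi_le_of_convexOn_of_eq_of_ne {d : ℕ} (γ η : Fin d → Measure ℝ)
    [∀ i, IsProbabilityMeasure (γ i)] [∀ i, IsProbabilityMeasure (η i)]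
    (hγ : ∀ i, Integrable (fun t => t) (γ i)) (hη : ∀ i, Integrable (fun t => t) (η i))
    (i : Fin d) (hne : ∀ j, j ≠ i → η j = γ j)
    (hcx : ∀ φ : ℝ → ℝ, ConvexOn ℝ Set.univ φ → Integrable φ (γ i) → Integrable φ (η i) →
      ∫ t, φ t ∂η i ≤ ∫ t, φ t ∂γ i)
    {F : (Fin d → ℝ) → ℝ} (hF : Measurable F) (hconv : ConvexOn ℝ Set.univ F) {C : Fin d → ℝ}
    (hC : ∀ z, |F z| ≤ ∑ i, C i * |z i|) :
    ∫ z, F z ∂Measure.pi η ≤ ∫ z, F z ∂Measure.pi γ := by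
  obtain _ | d := d
  · exact i.elim0
  have hFγ := integrable_pi_of_abs_le γ hγ hF hC
  have hFη := integrable_pi_of_abs_le η hη hF hC
  have hη' : (fun j => η (i.succAbove j)) = fun j => γ (i.succAbove j) :=
    funext fun j => hne _ (Fin.succAbove_ne i j)
  have mγ := (measurePreserving_piFinSuccAbove γ i).symm
  have mη := (measurePreserving_piFinSuccAbove η i).symm
  rw [hη'] at mη
  have iγ := (mγ.integrable_comp_emb (MeasurableEquiv.measurableEmbedding _)).2 hFγ
  have iη := (mη.integrable_comp_emb (MeasurableEquiv.measurableEmbedding _)).2 hFη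
  -- Fubini with coordinate `i` innermost: the outer law of the remaining coordinates `w` is the
  -- same on both sides, so sections in `i` can be compared.
  rw [← mγ.integral_comp', ← mη.integral_comp',
    integral_prod_symm (fun z => F ((MeasurableEquiv.piFinSuccAbove (fun _ => ℝ) i).symm z)) iη,
    integral_prod_symm (fun z => F ((MeasurableEquiv.piFinSuccAbove (fun _ => ℝ) i).symm z)) iγ]
  refine integral_mono iη.integral_prod_right iγ.integral_prod_right fun w => ?_
  have hm : Measurable fun t : ℝ => F (i.insertNth t w) :=
    hF.comp (measurable_pi_iff.2 fun j => by
      rcases Fin.eq_self_or_eq_succAbove i j with rfl | ⟨k, rfl⟩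
      · simpa using measurable_id'
      · simp)
  have hb : ∀ t, |F (i.insertNth t w)| ≤ C i * |t| + ∑ k, C (i.succAbove k) * |w k| := fun t => by
    refine (hC _).trans_eq ?_
    rw [Fin.sum_univ_succAbove _ i]
    simp
  have hint : ∀ ξ : Measure ℝ, IsProbabilityMeasure ξ → Integrable (fun t => t) ξ →
      Integrable (fun t : ℝ => F (i.insertNth t w)) ξ := fun ξ _ hξ =>
    ((hξ.abs.const_mul (C i)).add (integrable_const _)).mono' hm.aestronglyMeasurable
      (Filter.Eventually.of_forall hb)
  refine hcx (fun t => F (i.insertNth t w)) ⟨convex_univ, fun s _ t _ p q hp hq hpq => ?_⟩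
    (hint _ inferInstance (hγ i)) (hint _ inferInstance (hη i))
  have h := hconv.2 (Set.mem_univ (i.insertNth s w : Fin (d + 1) → ℝ))
    (Set.mem_univ (i.insertNth t w : Fin (d + 1) → ℝ)) hp hq hpq
  convert h using 2
  ext j
  rcases Fin.eq_self_or_eq_succAbove i j with rfl | ⟨k, rfl⟩
  · simp
  · simp [← add_mul, hpq]

/-- Random vectors with independent coordinates: if the coordinates decrease in the convex order,
then so does the vector, with respect to convex functions of linear growth. -/
theorem integral_pi_le_of_convexOn {d : ℕ} (γ η : Fin d → Measure ℝ)
    [∀ i, IsProbabilityMeasure (γ i)] [∀ i, IsProbabilityMeasure (η i)]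
    (hγ : ∀ i, Integrable (fun t => t) (γ i)) (hη : ∀ i, Integrable (fun t => t) (η i))
    (hcx : ∀ i, ∀ φ : ℝ → ℝ, ConvexOn ℝ Set.univ φ → Integrable φ (γ i) → Integrable φ (η i) →
      ∫ t, φ t ∂η i ≤ ∫ t, φ t ∂γ i)
    {F : (Fin d → ℝ) → ℝ} (hF : Measurable F) (hconv : ConvexOn ℝ Set.univ F) {C : Fin d → ℝ}
    (hC : ∀ z, |F z| ≤ ∑ i, C i * |z i|) :
    ∫ z, F z ∂Measure.pi η ≤ ∫ z, F z ∂Measure.pi γ := by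
  have hprob : ∀ (T : Finset (Fin d)) i, IsProbabilityMeasure (T.piecewise η γ i) := fun T i => by
    by_cases h : i ∈ T <;> simp only [h, Finset.piecewise, if_true, if_false] <;> infer_instance
  have hid : ∀ (T : Finset (Fin d)) i, Integrable (fun t => t) (T.piecewise η γ i) := fun T i => by
    by_cases h : i ∈ T <;> simp [h, hγ, hη]
  -- `T` is the set of coordinates already replaced.
  have key : ∀ T : Finset (Fin d),
      ∫ z, F z ∂Measure.pi (T.piecewise η γ) ≤ ∫ z, F z ∂Measure.pi γ := fun T => by
    induction T using Finset.induction_on with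
    | empty => simp
    | insert i T hi ih =>
      refine le_trans ?_ ih
      refine integral_pi_le_of_convexOn_of_eq_of_ne (T.piecewise η γ) ((insert i T).piecewise η γ)
        (hid _) (hid _) i (fun j hj => ?_) ?_ hF hconv hC
      · rw [Finset.piecewise_insert_of_ne _ _ _ hj]
      · simpa [hi] using hcx i
  simpa using key Finset.univ

/-- The law of the Gamma generator is a product of Gamma distributions with mean `1`. -/
lemma gammaGeneratorLaw_eq_pi {d : ℕ} {α : Fin d → ℝ} (hα : ∀ i, 0 < α i) :
    gammaGeneratorLaw α = Measure.pi fun i => gammaMeasure (α i) (α i) := by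
  have := fun i => isProbabilityMeasure_gammaMeasure (hα i) one_pos
  have := fun i => isProbabilityMeasure_gammaMeasure (hα i) (hα i)
  have h := fun i => map_div_gammaMeasure (hα i)
  have : ∀ i, SigmaFinite ((gammaMeasure (α i) 1).map fun g => g / α i) := fun i => by
    rw [h]; infer_instance
  rw [gammaGeneratorLaw]
  rw [Measure.pi_map_pi (f := fun i g => g / α i)
    (fun i => (measurable_id.div_const _).aemeasurable)]
  simp only [h]

/-- The Gamma generators decrease in the convex order as the shape parameters grow. -/
theorem integral_gammaGeneratorLaw_le_of_convexOn {d : ℕ} {α β : Fin d → ℝ} (hα : ∀ i, 0 < α i)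
    (hαβ : ∀ i, α i ≤ β i) {F : (Fin d → ℝ) → ℝ} (hF : Measurable F)
    (hconv : ConvexOn ℝ Set.univ F) {C : Fin d → ℝ} (hC : ∀ z, |F z| ≤ ∑ i, C i * |z i|) :
    ∫ z, F z ∂gammaGeneratorLaw β ≤ ∫ z, F z ∂gammaGeneratorLaw α := by
  have hβ : ∀ i, 0 < β i := fun i => (hα i).trans_le (hαβ i)
  have := fun i => isProbabilityMeasure_gammaMeasure (hα i) (hα i)
  have := fun i => isProbabilityMeasure_gammaMeasure (hβ i) (hβ i)
  rw [gammaGeneratorLaw_eq_pi hα, gammaGeneratorLaw_eq_pi hβ]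
  exact integral_pi_le_of_convexOn _ _ (fun i => integrable_id_gammaMeasure (hα i) (hα i))
    (fun i => integrable_id_gammaMeasure (hβ i) (hβ i))
    (fun i φ hφ h1 h2 => integral_gammaMeasure_le_of_convexOn (hα i) (hαβ i) hφ h1 h2) hF hconv hC

/-! ### Maxima of multiples of coordinates. -/

lemma continuous_iSup_apply {κ : Type*} [Finite κ] : Continuous fun w : κ → ℝ => ⨆ k, w k := by
  have := Fintype.ofFinite κ
  rcases isEmpty_or_nonempty κ with h | h
  · simpa only [Real.iSup_of_isEmpty] using continuous_const
  · simp_rw [← Finset.sup'_univ_eq_ciSup]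
    exact Continuous.finset_sup'_apply _ fun k _ => continuous_apply k

lemma convexOn_iSup_apply {κ : Type*} [Finite κ] :
    ConvexOn ℝ Set.univ fun w : κ → ℝ => ⨆ k, w k := by
  rcases isEmpty_or_nonempty κ with h | h
  · simpa only [Real.iSup_of_isEmpty] using convexOn_const (0 : ℝ) convex_univ
  · refine ⟨convex_univ, fun v _ w _ p q hp hq _ => ciSup_le fun k => ?_⟩
    have hv := le_ciSup (Set.finite_range v).bddAbove k
    have hw := le_ciSup (Set.finite_range w).bddAbove k
    simp only [Pi.add_apply, Pi.smul_apply, smul_eq_mul]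
    gcongr

/-- A crude bound in the shape of the linear growth hypothesis. The map `σ` and the free sign of `c`
cover both maxima over all coordinates and, through negation, minima over a subset. -/
lemma abs_iSup_mul_le {ι κ : Type*} [Fintype ι] [Fintype κ] (c : κ → ℝ) (σ : κ → ι) (z : ι → ℝ) :
    |⨆ k, c k * z (σ k)| ≤ ∑ i, (∑ k, |c k|) * |z i| := by
  have hnn : 0 ≤ ∑ i, (∑ k, |c k|) * |z i| := by positivity
  have hb : ∀ k, |c k * z (σ k)| ≤ ∑ i, (∑ k, |c k|) * |z i| := fun k => by
    rw [abs_mul]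
    refine (mul_le_mul_of_nonneg_right
      (Finset.single_le_sum (f := fun k => |c k|) (fun _ _ => abs_nonneg _) (Finset.mem_univ k))
      (abs_nonneg _)).trans ?_
    exact Finset.single_le_sum (f := fun i => (∑ k, |c k|) * |z i|)
      (fun _ _ => by positivity) (Finset.mem_univ (σ k))
  rcases isEmpty_or_nonempty κ with h | ⟨⟨k⟩⟩
  · simp
  · rw [abs_le]
    exact ⟨(abs_le.1 (hb k)).1.trans
      (le_ciSup (f := fun k => c k * z (σ k)) (Set.finite_range _).bddAbove k),
      Real.iSup_le (fun k => (abs_le.1 (hb k)).2) hnn⟩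

lemma measurable_iSup_mul {ι κ : Type*} [Finite ι] [Finite κ] (c : κ → ℝ) (σ : κ → ι) :
    Measurable fun z : ι → ℝ => ⨆ k, c k * z (σ k) :=
  (continuous_iSup_apply.comp (continuous_pi fun k =>
    continuous_const.mul (continuous_apply (σ k)))).measurable

lemma integrable_iSup_mul {ι κ : Type*} [Fintype ι] [Finite κ] {ρ : Measure (ι → ℝ)}
    (hρ : ∀ i, Integrable (fun z => z i) ρ) (c : κ → ℝ) (σ : κ → ι) :
    Integrable (fun z : ι → ℝ => ⨆ k, c k * z (σ k)) ρ := by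
  have := Fintype.ofFinite κ
  exact (integrable_finsetSum _ fun i _ => (hρ i).abs.const_mul _).mono'
    (measurable_iSup_mul c σ).aestronglyMeasurable
    (Filter.Eventually.of_forall fun z => abs_iSup_mul_le c σ z)

/-- For the Gamma generators, the mean of a maximum of multiples of coordinates decreases as the
shape parameters grow. -/
theorem integral_iSup_mul_gammaGeneratorLaw_le {d : ℕ} {κ : Type*} [Finite κ] {α β : Fin d → ℝ}
    (hα : ∀ i, 0 < α i) (hαβ : ∀ i, α i ≤ β i) (c : κ → ℝ) (σ : κ → Fin d) :
    ∫ z, (⨆ k, c k * z (σ k)) ∂gammaGeneratorLaw β ≤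
      ∫ z, (⨆ k, c k * z (σ k)) ∂gammaGeneratorLaw α := by
  have := Fintype.ofFinite κ
  refine integral_gammaGeneratorLaw_le_of_convexOn hα hαβ (measurable_iSup_mul c σ) ?_
    (abs_iSup_mul_le c σ)
  exact convexOn_iSup_apply.comp_linearMap
    (LinearMap.pi fun k => c k • LinearMap.proj (R := ℝ) (φ := fun _ : Fin d => ℝ) (σ k))

/-! ### Maximum-minimums identity and inclusion-exclusion. -/

open scoped NNReal in
/-- The maximum-minimums identity, with the minimum expressed through the maxima. -/
lemma sum_powerset_neg_one_pow_mul_sup {ι : Type*} [DecidableEq ι] {S : Finset ι}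
    (w : ι → ℝ≥0) {m : ℝ≥0} (hm : IsLeast (w '' S) m) :
    ∑ A ∈ S.powerset, (-1 : ℝ) ^ A.card * (A.sup w : ℝ≥0) = -(m : ℝ) := by
  induction S using Finset.induction_on generalizing w with
  | empty => simpa using hm.1
  | insert a S ha ih =>
    rw [Finset.sum_powerset_insert ha]
    rcases S.eq_empty_or_nonempty with rfl | hS
    · have : m = w a := by simpa using hm.1
      simp [this]
    have h0 : ∑ A ∈ S.powerset, (-1 : ℝ) ^ A.card = 0 := by
      exact_mod_cast Finset.sum_powerset_neg_one_pow_card_of_nonempty hS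
    -- This is `max = sum - min`. The terms `A.sup w` cancel against the subsets avoiding `a`, and
    -- the terms `w a` vanish in the alternating sum. The suprema of `w a ⊓ w i` remain, a family on
    -- `S` with the same minimum `m`.
    have hins : ∀ A ∈ S.powerset, (-1 : ℝ) ^ (insert a A).card * ((insert a A).sup w : ℝ≥0) =
        -((-1 : ℝ) ^ A.card * w a) - (-1 : ℝ) ^ A.card * (A.sup w : ℝ≥0) +
          (-1 : ℝ) ^ A.card * (A.sup fun i => w a ⊓ w i : ℝ≥0) := fun A hA => by
      have haA : a ∉ A := fun h => ha (Finset.mem_powerset.1 hA h)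
      have hsum : (((w a ⊔ A.sup w : ℝ≥0) : ℝ)) =
          w a + (A.sup w : ℝ≥0) - ((w a ⊓ A.sup w : ℝ≥0) : ℝ) := by
        rw [NNReal.coe_max, NNReal.coe_min, eq_sub_iff_add_eq, max_add_min]
      rw [Finset.card_insert_of_notMem haA, Finset.sup_insert, hsum, Finset.sup_inf_distrib_left]
      ring
    have hle : ∀ i ∈ insert a S, m ≤ w i := fun i hi => hm.2 ⟨i, hi, rfl⟩
    have hmin : IsLeast ((fun i => w a ⊓ w i) '' S) m := by
      refine ⟨?_, ?_⟩
      · obtain ⟨i, hi, him⟩ := hm.1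
        rcases Finset.mem_insert.1 (Finset.mem_coe.1 hi) with rfl | hi
        · obtain ⟨j, hj⟩ := hS
          refine ⟨j, hj, ?_⟩
          simp only [him]
          exact inf_eq_left.2 (hle j (Finset.mem_insert_of_mem hj))
        · refine ⟨i, hi, ?_⟩
          simp only [him]
          exact inf_eq_right.2 (hle a (Finset.mem_insert_self a S))
      · rintro _ ⟨i, hi, rfl⟩
        exact le_inf (hle a (Finset.mem_insert_self a S)) (hle i (Finset.mem_insert_of_mem hi))
    rw [Finset.sum_congr rfl hins, Finset.sum_add_distrib, Finset.sum_sub_distrib, ih _ hmin,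
      Finset.sum_neg_distrib, ← Finset.sum_mul, h0]
    ring

-- Entries outside `A` contribute zero, which is harmless for nonnegative values and agrees with the
-- empty supremum in `ℝ≥0`.
open scoped NNReal in
lemma iSup_ite_mul_eq_coe_sup {ι : Type*} [Finite ι] [DecidableEq ι] (A : Finset ι)
    {c z : ι → ℝ} (w : ι → ℝ≥0) (hw : ∀ i, c i * z i = w i) :
    ⨆ i, (if i ∈ A then c i else 0) * z i = (A.sup w : ℝ≥0) := by
  have hnn : ∀ i, 0 ≤ (if i ∈ A then c i else 0) * z i := fun i => by
    split_ifs
    · rw [hw]; exact NNReal.coe_nonneg _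
    · simp
  refine le_antisymm (Real.iSup_le (fun i => ?_) (NNReal.coe_nonneg _)) ?_
  · split_ifs with h
    · rw [hw]
      exact_mod_cast Finset.le_sup h
    · simp
  · have hle : A.sup w ≤ ⟨_, Real.iSup_nonneg hnn⟩ := Finset.sup_le fun i hi => by
      have h := le_ciSup (f := fun i => (if i ∈ A then c i else 0) * z i)
        (Set.finite_range _).bddAbove i
      simp only [hi, if_true, hw] at h
      exact_mod_cast h
    exact_mod_cast hle

-- The right side is minus the minimum over `S`, written as a maximum so that its convexity in `z`
-- is visible. For empty `S` both sides vanish, the real supremum of an empty family being `0`.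
open scoped NNReal in
lemma sum_powerset_neg_one_pow_mul_iSup {ι : Type*} [Finite ι] [DecidableEq ι] (S : Finset ι)
    {c z : ι → ℝ} (hc : ∀ i, 0 ≤ c i) (hz : ∀ i, 0 ≤ z i) :
    ∑ A ∈ S.powerset, (-1 : ℝ) ^ A.card * ⨆ i, (if i ∈ A then c i else 0) * z i =
      ⨆ i : S, -c i * z i := by
  obtain ⟨w, hw⟩ : ∃ w : ι → ℝ≥0, ∀ i, c i * z i = w i :=
    ⟨fun i => (c i * z i).toNNReal, fun i => (Real.coe_toNNReal _ (mul_nonneg (hc i) (hz i))).symm⟩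
  rcases S.eq_empty_or_nonempty with rfl | hS
  · simp
  obtain ⟨j, hj, hmin⟩ := S.exists_min_image w hS
  have hleast : IsLeast (w '' S) (w j) := ⟨⟨j, hj, rfl⟩, by
    rintro _ ⟨i, hi, rfl⟩
    exact hmin i hi⟩
  simp only [iSup_ite_mul_eq_coe_sup _ _ hw]
  rw [sum_powerset_neg_one_pow_mul_sup w hleast]
  have := hS.to_subtype
  simp only [neg_mul, hw]
  refine le_antisymm ?_ (ciSup_le fun i => neg_le_neg ?_)
  · exact le_ciSup (f := fun i : S => -((w i : ℝ≥0) : ℝ)) (Set.finite_range _).bddAbove ⟨j, hj⟩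
  · exact_mod_cast hmin i i.2

/-- Inclusion-exclusion for a random finite set `N`. -/
lemma sum_mul_measureReal_subset {Ω ι : Type*} [Fintype ι] [DecidableEq ι] [MeasurableSpace Ω]
    (P : Measure Ω) [IsFiniteMeasure P] {N : Ω → Finset ι}
    (hN : ∀ A, MeasurableSet {ω | A ⊆ N ω}) (g : Finset ι → ℝ) :
    ∑ A, g A * P.real {ω | A ⊆ N ω} = ∫ ω, ∑ A ∈ (N ω).powerset, g A ∂P := by
  have h : ∀ ω, ∑ A ∈ (N ω).powerset, g A =
      ∑ A, {ω | A ⊆ N ω}.indicator (fun _ => g A) ω := fun ω => by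
    simp only [Set.indicator_apply, Set.mem_ofPred_eq, ← Finset.mem_powerset]
    rw [Finset.sum_ite_mem, Finset.univ_inter]
  simp only [h]
  rw [integral_finsetSum _ fun A _ => (integrable_const _).indicator (hN A)]
  refine Finset.sum_congr rfl fun A _ => ?_
  rw [integral_indicator_const _ (hN A), smul_eq_mul, mul_comm]

/-! ### Simple max-stable distributions and their lower orthants. -/

open Filter Topology in
/-- The distribution function of a simple max-stable distribution, with some arguments allowed to
be infinite: the argument is the vector of reciprocals `c`. -/
lemma IsGenerator.measureReal_setOf_mul_le_one {d : ℕ} {ρ μ : Measure (Fin d → ℝ)}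
    (h : IsGenerator ρ μ) {c : Fin d → ℝ} (hc : ∀ i, 0 ≤ c i) :
    μ.real {x | ∀ i, c i * x i ≤ 1} = Real.exp (-∫ z, (⨆ i, c i * z i) ∂ρ) := by
  have := h.isProbabilityMeasure
  have hpos : ∀ c : Fin d → ℝ, (∀ i, 0 < c i) →
      μ.real {x | ∀ i, c i * x i ≤ 1} = Real.exp (-∫ z, (⨆ i, c i * z i) ∂ρ) := fun c hc => by
    have e := h.cdf_eq (fun i => (c i)⁻¹) fun i => inv_pos.2 (hc i)
    simp only [div_inv_eq_mul, mul_comm _ (c _)] at e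
    rw [← e, lowerOrthant]
    congr 1
    ext x
    simp only [Set.mem_ofPred_eq]
    refine forall_congr' fun i => ?_
    rw [← one_div, le_div_iff₀ (hc i), mul_comm]
  -- Vanishing entries are approached from above by `1 / (n + 1)`. The constraint there reads `x i ≤
  -- n + 1`, so the events increase to the one with no constraint on that coordinate.
  set u : ℕ → Fin d → ℝ := fun n i => if c i = 0 then 1 / ((n : ℝ) + 1) else c i with hu
  have hupos : ∀ n i, 0 < u n i := fun n i => by
    simp only [hu]
    split_ifs with h0
    · exact Nat.one_div_pos_of_nat
    · exact lt_of_le_of_ne (hc i) (Ne.symm h0)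
  have hule : ∀ n i, |u n i| ≤ c i + 1 := fun n i => by
    rw [abs_of_pos (hupos n i)]
    simp only [hu]
    split_ifs with h0
    · rw [h0, zero_add, div_le_one (by positivity)]
      linarith [(Nat.cast_nonneg n : (0 : ℝ) ≤ n)]
    · linarith
  have hulim : ∀ i, Tendsto (fun n => u n i) atTop (𝓝 (c i)) := fun i => by
    simp only [hu]
    split_ifs with h0
    · rw [h0]; exact tendsto_one_div_add_atTop_nhds_zero_nat
    · exact tendsto_const_nhds
  have hmono : Monotone fun n => {x : Fin d → ℝ | ∀ i, u n i * x i ≤ 1} := fun m n hmn x hx i => by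
    have hxi := hx i
    simp only [hu] at hxi ⊢
    split_ifs at hxi ⊢ with h0
    · rw [one_div_mul_eq_div, div_le_one (by positivity)] at hxi ⊢
      have : (m : ℝ) ≤ n := by exact_mod_cast hmn
      linarith
    · exact hxi
  have hUnion : ⋃ n, {x : Fin d → ℝ | ∀ i, u n i * x i ≤ 1} = {x | ∀ i, c i * x i ≤ 1} := by
    ext x
    simp only [Set.mem_iUnion, Set.mem_ofPred_eq]
    constructor
    · rintro ⟨n, hn⟩ i
      have hni := hn i
      simp only [hu] at hni
      split_ifs at hni with h0
      · simp [h0]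
      · exact hni
    · intro hx
      obtain ⟨n, hn⟩ := exists_nat_ge (∑ i, |x i|)
      refine ⟨n, fun i => ?_⟩
      simp only [hu]
      split_ifs with h0
      · rw [one_div_mul_eq_div, div_le_one (by positivity)]
        have h1 := Finset.single_le_sum (f := fun i => |x i|) (fun _ _ => abs_nonneg _)
          (Finset.mem_univ i)
        have h2 := le_abs_self (x i)
        linarith
      · exact hx i
  have hlim1 : Tendsto (fun n => μ.real {x : Fin d → ℝ | ∀ i, u n i * x i ≤ 1}) atTop
      (𝓝 (μ.real {x | ∀ i, c i * x i ≤ 1})) := by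
    rw [← hUnion]
    exact (ENNReal.tendsto_toReal (measure_ne_top _ _)).comp (tendsto_measure_iUnion_atTop hmono)
  have hlim2 : Tendsto (fun n => ∫ z, (⨆ i, u n i * z i) ∂ρ) atTop
      (𝓝 (∫ z, (⨆ i, c i * z i) ∂ρ)) := by
    refine tendsto_integral_of_dominated_convergence
      (fun z => ∑ i, (∑ k, (c k + 1)) * |z i|)
      (fun n => (measurable_iSup_mul (u n) id).aestronglyMeasurable)
      (integrable_finsetSum _ fun i _ => (h.integrable i).abs.const_mul _)
      (fun n => Eventually.of_forall fun z => (abs_iSup_mul_le (u n) id z).trans ?_)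
      (Eventually.of_forall fun z => ?_)
    · gcongr
      exact hule n _
    · exact (continuous_iSup_apply.tendsto fun i => c i * z i).comp
        (tendsto_pi_nhds.2 fun i => (hulim i).mul_const _)
  refine tendsto_nhds_unique hlim1 ?_
  simp only [hpos _ (hupos _)]
  exact (Real.continuous_exp.tendsto _).comp hlim2.neg

lemma IsGenerator.integrable_iSup_mul {d : ℕ} {ρ μ : Measure (Fin d → ℝ)}
    (h : IsGenerator ρ μ) {κ : Type*} [Finite κ] (c : κ → ℝ) (σ : κ → Fin d) :
    Integrable (fun z : Fin d → ℝ => ⨆ k, c k * z (σ k)) ρ :=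
  _root_.integrable_iSup_mul h.integrable c σ

/-- A simple max-stable distribution is concentrated on `(0, ∞)ᵈ`. -/
lemma IsGenerator.ae_pos {d : ℕ} {ρ μ : Measure (Fin d → ℝ)} (h : IsGenerator ρ μ) :
    ∀ᵐ x ∂μ, ∀ i, 0 < x i := by
  have := h.isProbabilityMeasure
  refine ae_all_iff.2 fun i => ?_
  -- If `x i ≤ 0` then `n * x i ≤ 1` for every `n`. The latter event has exponent at least `n * E
  -- Z_i = n`.
  have hbound : ∀ n : ℕ, μ.real {x | ¬ 0 < x i} ≤ Real.exp (-(n : ℝ)) := fun n => by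
    have hc : ∀ j, 0 ≤ if j = i then (n : ℝ) else 0 := fun j => by split_ifs <;> simp
    refine (measureReal_mono (s₂ := {x : Fin d → ℝ | ∀ j, (if j = i then (n : ℝ) else 0) * x j ≤ 1})
      fun x hx j => ?_).trans ?_
    · split_ifs with hj
      · subst hj
        have h1 : (n : ℝ) * x j ≤ 0 :=
          mul_nonpos_of_nonneg_of_nonpos (Nat.cast_nonneg n) (not_lt.1 hx)
        linarith
      · simp
    · rw [h.measureReal_setOf_mul_le_one hc, Real.exp_le_exp, neg_le_neg_iff]
      calc (n : ℝ) = ∫ z, (n : ℝ) * z i ∂ρ := by rw [integral_const_mul, h.mean_one, mul_one]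
        _ ≤ _ := by
          refine integral_mono ((h.integrable i).const_mul _)
            (h.integrable_iSup_mul (fun j => if j = i then (n : ℝ) else 0) id) fun z => ?_
          have := le_ciSup (f := fun j => (if j = i then (n : ℝ) else 0) * z j)
            (Set.finite_range _).bddAbove i
          simpa using this
  have h0 : μ.real {x | ¬ 0 < x i} = 0 := by
    refine le_antisymm (ge_of_tendsto' (Real.tendsto_exp_neg_atTop_nhds_zero.comp
      tendsto_natCast_atTop_atTop) hbound) measureReal_nonneg
  rw [ae_iff]
  exact (measureReal_eq_zero_iff).1 h0

/-- The lower orthants of simple max-stable distributions are compared through their exponent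
functions. -/
theorem IsGenerator.leLO {d : ℕ} {ρ ξ μ ν : Measure (Fin d → ℝ)} (hμ : IsGenerator ρ μ)
    (hν : IsGenerator ξ ν)
    (hV : ∀ c : Fin d → ℝ, ∫ z, (⨆ i, c i * z i) ∂ξ ≤ ∫ z, (⨆ i, c i * z i) ∂ρ) :
    LeLO ν μ := by
  have := hμ.isProbabilityMeasure
  have := hν.isProbabilityMeasure
  intro a
  by_cases ha : ∀ i, 0 < a i
  · have e := hμ.cdf_eq a ha
    have e' := hν.cdf_eq a ha
    rw [← ENNReal.toReal_le_toReal (measure_ne_top _ _) (measure_ne_top _ _)]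
    change μ.real _ ≤ ν.real _
    rw [e, e', Real.exp_le_exp, neg_le_neg_iff]
    simpa only [div_eq_inv_mul] using hV fun i => (a i)⁻¹
  · push Not at ha
    obtain ⟨i, hi⟩ := ha
    have : μ (lowerOrthant a) = 0 := by
      refine measure_mono_null (fun x hx => ?_) (ae_iff.1 hμ.ae_pos)
      exact fun hx' => absurd ((hx' i).trans_le (hx i)) (not_lt.2 hi)
    rw [this]
    exact zero_le

/-! ### Upper orthants. -/

section UpperOrthant

variable {d : ℕ} {ρ ξ μ ν : Measure (Fin d → ℝ)} {c : Fin d → ℝ}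

/-- The exponent function at the coordinates in `A`. -/
noncomputable def exponentOn (ρ : Measure (Fin d → ℝ)) (c : Fin d → ℝ) (A : Finset (Fin d)) : ℝ :=
  ∫ z, (⨆ i, (if i ∈ A then c i else 0) * z i) ∂ρ

/-- The exponent is homogeneous in `c`. The value `s = 0` is included, where the event is the whole
space; the ends of the interpolation path need it. -/
lemma IsGenerator.measureReal_setOf_forall_mem (h : IsGenerator ρ μ) (hc : ∀ i, 0 ≤ c i) {s : ℝ}
    (hs : 0 ≤ s) (A : Finset (Fin d)) :
    μ.real {x | ∀ i ∈ A, s * c i * x i ≤ 1} = Real.exp (-(s * exponentOn ρ c A)) := by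
  have h0 := h.measureReal_setOf_mul_le_one (c := fun i => s * if i ∈ A then c i else 0)
    fun i => mul_nonneg hs (by split_ifs <;> simp [hc])
  simp only [mul_assoc, ← Real.mul_iSup_of_nonneg hs, integral_const_mul] at h0
  rw [exponentOn, ← h0]
  congr 1
  ext x
  simp only [Set.mem_ofPred_eq, mul_assoc]
  refine forall_congr' fun i => ?_
  by_cases hi : i ∈ A <;> simp [hi]

/-- This turns alternating sums of exponents into means of convex functions of the generator, which
the convex order controls. -/
lemma IsGenerator.sum_powerset_exponentOn (h : IsGenerator ρ μ) (hc : ∀ i, 0 ≤ c i)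
    (S : Finset (Fin d)) :
    ∑ A ∈ S.powerset, (-1 : ℝ) ^ A.card * exponentOn ρ c A = ∫ z, (⨆ i : S, -c i * z i) ∂ρ := by
  simp only [exponentOn, ← integral_const_mul]
  have hint : ∀ A : Finset (Fin d),
      Integrable (fun z => (-1 : ℝ) ^ A.card * ⨆ i, (if i ∈ A then c i else 0) * z i) ρ :=
    fun A => (h.integrable_iSup_mul (fun i => if i ∈ A then c i else 0) id).const_mul _
  rw [← integral_finsetSum _ fun A _ => hint A]
  refine integral_congr_ae ?_
  filter_upwards [h.nonneg] with z hz
  exact sum_powerset_neg_one_pow_mul_iSup S hc hz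

/-- Let `N x` be the set of coordinates that fail to exceed `1 / c i`. The alternating sum over its
subsets is the indicator of `N x = ∅`, that is, of the orthant. -/
lemma IsGenerator.measureReal_upperOrthant (h : IsGenerator ρ μ) (hc : ∀ i, 0 < c i) :
    μ.real (upperOrthant fun i => (c i)⁻¹) =
      ∑ A, (-1 : ℝ) ^ A.card * Real.exp (-exponentOn ρ c A) := by
  have := h.isProbabilityMeasure
  set N : (Fin d → ℝ) → Finset (Fin d) := fun x => Finset.univ.filter fun i => c i * x i ≤ 1 with hN
  have hset : ∀ A, {x | A ⊆ N x} = {x | ∀ i ∈ A, 1 * c i * x i ≤ 1} := fun A => by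
    ext x
    simp [hN, Finset.subset_iff]
  have hmeas : ∀ A, MeasurableSet {x | A ⊆ N x} := fun A => by
    rw [hset]
    measurability
  have key := sum_mul_measureReal_subset μ hmeas fun A => (-1 : ℝ) ^ A.card
  simp only [hset, h.measureReal_setOf_forall_mem (fun i => (hc i).le) zero_le_one] at key
  simp only [one_mul] at key
  have hup : MeasurableSet (upperOrthant fun i => (c i)⁻¹) := by
    unfold upperOrthant
    measurability
  rw [key, ← integral_indicator_one hup]
  refine integral_congr_ae (Filter.Eventually.of_forall fun x => ?_)
  have hcard : ∑ A ∈ (N x).powerset, (-1 : ℝ) ^ A.card = if N x = ∅ then 1 else 0 := by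
    exact_mod_cast Finset.sum_powerset_neg_one_pow_card (x := N x)
  have hiff : x ∈ (upperOrthant fun i => (c i)⁻¹) ↔ N x = ∅ := by
    simp only [upperOrthant, Set.mem_ofPred_eq, hN, Finset.filter_eq_empty_iff, Finset.mem_univ,
      forall_true_left, not_le]
    refine forall_congr' fun i => ?_
    rw [inv_lt_iff_one_lt_mul₀' (hc i)]
  beta_reduce
  rw [hcard]
  by_cases hx : N x = ∅
  · rw [Set.indicator_of_mem (hiff.2 hx), if_pos hx, Pi.one_apply]
  · rw [Set.indicator_of_notMem (mt hiff.1 hx), if_neg hx]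

/-- The survival functions at points of `(0, ∞)ᵈ` are compared along the path that joins the two
distributions through the maxima of rescaled independent copies. -/
lemma IsGenerator.measureReal_upperOrthant_inv_le (hμ : IsGenerator ρ μ) (hν : IsGenerator ξ ν)
    (hc : ∀ i, 0 < c i)
    (hV : ∀ S : Finset (Fin d),
      ∫ z, (⨆ i : S, -c i * z i) ∂ξ ≤ ∫ z, (⨆ i : S, -c i * z i) ∂ρ) :
    μ.real (upperOrthant fun i => (c i)⁻¹) ≤ ν.real (upperOrthant fun i => (c i)⁻¹) := by
  have := hμ.isProbabilityMeasure
  have := hν.isProbabilityMeasure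
  have hc0 : ∀ i, 0 ≤ c i := fun i => (hc i).le
  -- `Φ` is the survival probability of `max((1 - s) X, s Y)` at `1 / c`: it belongs to `μ` at `s =
  -- 0` and to `ν` at `s = 1`.
  set e : Finset (Fin d) → ℝ → ℝ := fun A s =>
    Real.exp (-((1 - s) * exponentOn ρ c A) + -(s * exponentOn ξ c A)) with he
  set Φ : ℝ → ℝ := fun s => ∑ A, (-1 : ℝ) ^ A.card * e A s with hΦ
  have hderiv : ∀ s, HasDerivAt Φ
      (∑ A, ((-1 : ℝ) ^ A.card * (exponentOn ρ c A - exponentOn ξ c A)) * e A s) s := fun s => by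
    refine HasDerivAt.fun_sum fun A _ => ?_
    have h1 : HasDerivAt (fun s : ℝ => -((1 - s) * exponentOn ρ c A) + -(s * exponentOn ξ c A))
        (exponentOn ρ c A - exponentOn ξ c A) s := by
      convert! ((((hasDerivAt_id s).const_sub 1).mul_const (exponentOn ρ c A)).neg).add
        ((hasDerivAt_id s).mul_const (exponentOn ξ c A)).neg using 1
      ring
    convert! (h1.exp).const_mul ((-1 : ℝ) ^ A.card) using 1
    simp only [he]
    ring
  have hnonneg : ∀ s ∈ Set.Icc (0 : ℝ) 1,
      0 ≤ ∑ A, ((-1 : ℝ) ^ A.card * (exponentOn ρ c A - exponentOn ξ c A)) * e A s := by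
    rintro s ⟨hs0, hs1⟩
    -- The coordinates at which `max((1 - s) X, s Y)` is at most `1 / c i`. By independence `e A s`
    -- is the probability that `A ⊆ N`.
    set N : (Fin d → ℝ) × (Fin d → ℝ) → Finset (Fin d) := fun p =>
      Finset.univ.filter fun i => (1 - s) * c i * p.1 i ≤ 1 ∧ s * c i * p.2 i ≤ 1 with hN
    have hset : ∀ A, {p | A ⊆ N p} =
        {x | ∀ i ∈ A, (1 - s) * c i * x i ≤ 1} ×ˢ {x | ∀ i ∈ A, s * c i * x i ≤ 1} := fun A => by
      ext p
      simp [hN, Finset.subset_iff, forall_and]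
    have hmeas : ∀ A, MeasurableSet {p | A ⊆ N p} := fun A => by
      rw [hset]
      refine MeasurableSet.prod ?_ ?_ <;> measurability
    have hreal : ∀ A, (μ.prod ν).real {p | A ⊆ N p} = e A s := fun A => by
      rw [hset, measureReal_prod_prod, hμ.measureReal_setOf_forall_mem hc0 (sub_nonneg.2 hs1),
        hν.measureReal_setOf_forall_mem hc0 hs0, ← Real.exp_add]
    simp only [← hreal]
    -- The derivative becomes a mean over `p`, and its integrand is the hypothesis `hV` at the set
    -- `N p`.
    rw [sum_mul_measureReal_subset (μ.prod ν) hmeas]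
    refine integral_nonneg fun p => ?_
    simp only [mul_sub, Finset.sum_sub_distrib]
    rw [hμ.sum_powerset_exponentOn hc0, hν.sum_powerset_exponentOn hc0]
    exact sub_nonneg.2 (hV _)
  have hmono : MonotoneOn Φ (Set.Icc 0 1) := by
    refine monotoneOn_of_deriv_nonneg (convex_Icc 0 1)
      (fun s _ => (hderiv s).continuousAt.continuousWithinAt)
      (fun s _ => (hderiv s).differentiableAt.differentiableWithinAt) fun s hs => ?_
    rw [(hderiv s).deriv]
    exact hnonneg s (interior_subset hs)
  have h01 := hmono (Set.left_mem_Icc.2 zero_le_one) (Set.right_mem_Icc.2 zero_le_one) zero_le_one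
  rw [hμ.measureReal_upperOrthant hc, hν.measureReal_upperOrthant hc]
  simpa [hΦ, he] using h01

/-- The upper orthants of simple max-stable distributions are compared through the means of the
minima of multiples of the coordinates of their generators. -/
theorem IsGenerator.leUO (hμ : IsGenerator ρ μ) (hν : IsGenerator ξ ν)
    (hV : ∀ (c : Fin d → ℝ) (S : Finset (Fin d)),
      ∫ z, (⨆ i : S, -c i * z i) ∂ξ ≤ ∫ z, (⨆ i : S, -c i * z i) ∂ρ) :
    LeUO μ ν := by
  have := hμ.isProbabilityMeasure
  have := hν.isProbabilityMeasure
  intro a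
  -- Entries of `a` may be nonpositive, so they are raised to `1 / (n + 1)`. As `μ` lives on `(0,
  -- ∞)ᵈ`, these smaller orthants exhaust that of `a` up to a `μ`-null set; for `ν` inclusion is
  -- enough.
  set u : ℕ → Fin d → ℝ := fun n i => max (a i) (1 / ((n : ℝ) + 1)) with hu
  have hupos : ∀ n i, 0 < u n i := fun n i => lt_max_of_lt_right Nat.one_div_pos_of_nat
  have hle : ∀ n, μ (upperOrthant (u n)) ≤ ν (upperOrthant a) := fun n => by
    have h := hμ.measureReal_upperOrthant_inv_le hν (c := fun i => (u n i)⁻¹)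
      (fun i => inv_pos.2 (hupos n i)) (hV fun i => (u n i)⁻¹)
    simp only [inv_inv] at h
    refine ((ENNReal.toReal_le_toReal (measure_ne_top _ _) (measure_ne_top _ _)).1 h).trans
      (measure_mono fun x hx i => (le_max_left _ _).trans_lt (hx i))
  have hmono : Monotone fun n => upperOrthant (u n) := fun m n hmn x hx i => by
    refine lt_of_le_of_lt (max_le_max le_rfl ?_) (hx i)
    exact Nat.one_div_le_one_div hmn
  have hsub : upperOrthant a ≤ᵐ[μ] ⋃ n, upperOrthant (u n) := by
    filter_upwards [hμ.ae_pos] with x hx hxa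
    have hex : ∀ i, ∃ n : ℕ, 1 / ((n : ℝ) + 1) < x i := fun i => exists_nat_one_div_lt (hx i)
    choose n hn using hex
    refine Set.mem_iUnion.2 ⟨Finset.univ.sup n, fun i => max_lt (hxa i) ((hn i).trans_le' ?_)⟩
    exact Nat.one_div_le_one_div (Finset.le_sup (Finset.mem_univ i))
  refine (measure_mono_ae hsub).trans ?_
  rw [hmono.measure_iUnion]
  exact iSup_le hle

end UpperOrthant

theorem theorem4p5 {d : ℕ} (α β : Fin d → ℝ) (hαβ : ∀ i, α i ≤ β i)
    (μ ν : Measure (Fin d → ℝ)) (hμ : IsMaxDir α μ) (hν : IsMaxDir β ν) :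
    LePQD μ ν :=
  ⟨hμ.2.leUO hν.2 fun c S => integral_iSup_mul_gammaGeneratorLaw_le hμ.1 hαβ
      (fun i : S => -c i) Subtype.val,
    hμ.2.leLO hν.2 fun c => integral_iSup_mul_gammaGeneratorLaw_le hμ.1 hαβ c id⟩
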